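/- Let $N\ge 2$. For every $T>0$ let $H=H_T:[0,1]\to\mathbb{C}^{N\times N}$ be a three times differentiable family of Hermitian matrices, let $U(s,0)$, $s\in[0,1]$, be the solution of $\partial_s U(s,0)=-iT\,H(s)\,U(s,0)$, $U(0,0)=\mathbb 1$, and let $|G(s)\rangle$ be a normalized eigenvector of $H(s)$ whose eigenvalue $E_G(s)$ depends continuously on $s\in[0,1]$ and is non-degenerate for every $s\in[0,1]$. Let $\|\dot H\|,\|\ddot H\|,\|\dddot H\|$ be the suprema over $s\in[0,1]$ of the operator norms of the first three derivatives of $H$. Let $\gamma_{\min}$ be the infimum over $s\in[0,1]$ of $|E-E'|$ over all pairs of distinct eigenvalues $E,E'$ of $H(s)$, and let $\min_\nu\gamma_{\nu,G}(s)$ be the minimum of $|E-E_G(s)|$ over all eigenvalues $E\neq E_G(s)$ of $H(s)$. Assume that, as $T\to\infty$, $\|\ddot H\|\in o(\sqrt T)$ and $\|\dddot H\|\in o(T)$, and that $\|\dot H\|$ and $(\gamma_{\min})^{-1}$ are bounded above by constants that do not depend on $T>0$. Put $P_G(1)=|G(1)\rangle\langle G(1)|$ and $$B(T)=\max_{s=0,1}\left[\frac{\|\dot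 H(s)\|}{\min_\nu[\gamma_{\nu,G}(s)]^2\,T}\right].$$ If the leading-order coefficient $T\,B(T)$ does not degenerate, i.e. is bounded below by a positive constant for all sufficiently large $T$, then, as $T\to\infty$, $$\left\|(\mathbb 1-P_G(1))\,U(1,0)|G(0)\rangle\right\|\in O\left(\max_{s=0,1}\left[\frac{\|\dot H(s)\|}{\min_\nu[\gamma_{\nu,G}(s)]^2\,T}\right]\right).$$ Without this condition on $T\,B(T)$ there is a constant $C$ with $$\left\|(\mathbb 1-P_G(1))\,U(1,0)|G(0)\rangle\right\|\le C\,B(T)+o(1/T)\qquad(T\to\infty).$$ -/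

import Mathlib

open Set Filter Topology Asymptotics
open scoped ENNReal NNReal

noncomputable section

section HilbertSpace

variable {V : Type*} [NormedAddCommGroup V] [InnerProductSpace ℂ V]

/-- The set of energies (real eigenvalues) of an operator. -/
def energies (A : V →L[ℂ] V) : Set ℝ :=
  {E | Module.End.HasEigenvalue (A : V →ₗ[ℂ] V) (E : ℂ)}

/-- The `k`-th derivative of `H` on the interval `[0,1]` (one-sided at the end points). -/
def hamDeriv (k : ℕ) (H : ℝ → V →L[ℂ] V) : ℝ → V →L[ℂ] V :=
  iteratedDerivWithin k H (Icc 0 1)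

/-- `H` is differentiable three times on `[0,1]`; the third derivative need not be continuous. -/
def ThriceDifferentiable (H : ℝ → V →L[ℂ] V) : Prop :=
  ∀ k < 3, DifferentiableOn ℝ (hamDeriv k H) (Icc 0 1)

/-- `G` is an instantaneous non-degenerate (normalized) eigenstate of `H` on `[0,1]`, belonging to
the energy level `E`: the level varies continuously, and each `E s` is an eigenvalue of
multiplicity one of `H s`. -/
structure IsNondegenerateEigenstate (H : ℝ → V →L[ℂ] V) (E : ℝ → ℝ) (G : ℝ → V) : Prop where
  level_continuous : ContinuousOn E (Icc 0 1)
  norm_eq_one : ∀ s ∈ Icc (0 : ℝ) 1, ‖G s‖ = 1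
  eigen : ∀ s ∈ Icc (0 : ℝ) 1, H s (G s) = (E s : ℂ) • G s
  nondegenerate : ∀ s ∈ Icc (0 : ℝ) 1,
    Module.finrank ℂ (Module.End.eigenspace (H s : V →ₗ[ℂ] V) (E s : ℂ)) = 1

/-- The minimum over `s ∈ [0,1]` of the gaps between any two distinct eigenvalues of `H s`
(an infimum in `[0,∞]`, so that its inverse is `∞` if gaps get arbitrarily small). -/
def gapMin (H : ℝ → V →L[ℂ] V) : ℝ≥0∞ :=
  ⨅ s ∈ Icc (0 : ℝ) 1, ⨅ E ∈ energies (H s), ⨅ E' ∈ energies (H s), ⨅ _ : E ≠ E',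
    ENNReal.ofReal |E - E'|

/-- The minimum gap between the eigenvalue `E` of `A` and the other eigenvalues of `A`
(for a Hermitian matrix, the minimum of a finite set, non-empty unless `A = E • 1`). -/
def levelGap (A : V →L[ℂ] V) (E : ℝ) : ℝ :=
  sInf {g | ∃ E' ∈ energies A, E' ≠ E ∧ g = |E' - E|}

/-- `U s` is the time-evolution operator `U(s,0)` generated by `H` in the dimensionless time
`s = t / T`: the solution on `[0,1]` of `dU/ds = -i T H(s) U(s)`, `U(0) = 1`. -/
structure IsTimeEvolution (T : ℝ) (H : ℝ → V →L[ℂ] V) (U : ℝ → V →L[ℂ] V) : Prop where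
  initial : U 0 = 1
  schrodinger : ∀ s ∈ Icc (0 : ℝ) 1,
    HasDerivWithinAt U ((-(Complex.I * (T : ℂ))) • (H s * U s)) (Icc 0 1) s

/-- The error `‖(1 - |G(1)⟩⟨G(1)|) U(1,0) |G(0)⟩‖` of the adiabatic approximation. -/
def adiabaticError (G : ℝ → V) (U : ℝ → V →L[ℂ] V) : ℝ :=
  ‖((1 : V →L[ℂ] V) - InnerProductSpace.rankOne ℂ (G 1) (G 1)) (U 1 (G 0))‖

/-- The quantity `max_{s = 0, 1} ‖H'(s)‖ / (min_ν γ_{ν,G}(s)² T)`. -/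
def standardEstimate (T : ℝ) (H : ℝ → V →L[ℂ] V) (E : ℝ → ℝ) : ℝ :=
  max (‖hamDeriv 1 H 0‖ / (levelGap (H 0) (E 0) ^ 2 * T))
    (‖hamDeriv 1 H 1‖ / (levelGap (H 1) (E 1) ^ 2 * T))

/-- For a family `H T`, `T > 0`, of Hamiltonians on `[0,1]`: the derivative of order `k` satisfies
`sup_{s ∈ [0,1]} ‖(d/ds)^k H T s‖ ∈ o(g T)` as `T → ∞`. -/
def DerivNormIsLittleO (k : ℕ) (H : ℝ → ℝ → V →L[ℂ] V) (g : ℝ → ℝ) : Prop :=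
  ∀ ε > 0, ∀ᶠ T in atTop, ∀ s ∈ Icc (0 : ℝ) 1, ‖hamDeriv k (H T) s‖ ≤ ε * g T

/-- The norm of the derivative of order `k` is bounded, uniformly in `s ∈ [0,1]`, by a constant
that does not depend on `T > 0`. -/
def DerivNormBounded (k : ℕ) (H : ℝ → ℝ → V →L[ℂ] V) : Prop :=
  ∃ b : ℝ, ∀ T > 0, ∀ s ∈ Icc (0 : ℝ) 1, ‖hamDeriv k (H T) s‖ ≤ b

end HilbertSpace

/-- The state space `ℂᴺ` with its Euclidean norm. -/
abbrev StateSpace (N : ℕ) : Type := EuclideanSpace ℂ (Fin N)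

/-- Linear operators on `ℂᴺ`, that is, complex `N × N` matrices, normed by the operator norm. -/
abbrev Op (N : ℕ) : Type := StateSpace N →L[ℂ] StateSpace N

end

/-!
Besides the spectral projection `P = |G⟩⟨G|`, consider the superadiabatic projection
`P + T⁻¹ D + T⁻² F`, whose coefficients solve `P' = -i [H, D]` and `D' = -i [H, F]`. It is
intertwined by the evolution up to the residual `T⁻² F'`, because the terms of orders `T`, `1` and
`T⁻¹` cancel. Each derivative of `H` after the first costs a factor `o(√T)`, so `T⁻² F` and
`T⁻² F'` are `o(1/T)`. Hence, up to `o(1/T)`, the transition amplitude out of `P` consists of the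
boundary terms `T⁻¹ (1 - P) D` at `s = 1` and `T⁻¹ D P` at `s = 0`. Both are the reduced resolvent
of `H` applied twice to `H' P`, which gives `‖H'‖ / (gap² T)`.
-/

/-- `P` is the spectral projection of `Z` for the isolated eigenvalue `0`, and `R` is the reduced
resolvent: the inverse of `Z` on the range of `1 - P`, extended by zero to the range of `P`. -/
structure IsReducedResolvent {A : Type*} [Ring A] (Z P R : A) : Prop where
  proj_mul_proj : P * P = P
  gen_mul_proj : Z * P = 0
  proj_mul_gen : P * Z = 0
  gen_mul_res : Z * R = 1 - P
  res_mul_gen : R * Z = 1 - P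
  res_mul_proj : R * P = 0
  proj_mul_res : P * R = 0

namespace IsReducedResolvent

section Ring

variable {A : Type*} [Ring A] {Z P R Z₀ P₀ R₀ : A}

theorem of_isUnit_add (hP : P * P = P) (hZP : Z * P = 0) (hPZ : P * Z = 0) (hu : IsUnit (Z + P)) :
    IsReducedResolvent Z P (Ring.inverse (Z + P) - P) := by
  set B := Ring.inverse (Z + P)
  have hB : (Z + P) * B = 1 := Ring.mul_inverse_cancel _ hu
  have hB' : B * (Z + P) = 1 := Ring.inverse_mul_cancel _ hu
  have hBP : B * P = P :=
    calc B * P = B * ((Z + P) * P) := by rw [add_mul, hZP, hP, zero_add]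
      _ = P := by rw [← mul_assoc, hB', one_mul]
  have hPB : P * B = P :=
    calc P * B = P * (Z + P) * B := by rw [mul_add, hPZ, hP, zero_add]
      _ = P := by rw [mul_assoc, hB, mul_one]
  refine ⟨hP, hZP, hPZ, ?_, ?_, ?_, ?_⟩
  · rw [mul_sub, hZP, sub_zero, ← hB, add_mul, hPB, add_sub_cancel_right]
  · rw [sub_mul, hPZ, sub_zero, ← hB', mul_add, hBP, add_sub_cancel_right]
  · rw [sub_mul, hBP, hP, sub_self]
  · rw [mul_sub, hPB, hP, sub_self]

theorem compl_mul_proj (h : IsReducedResolvent Z P R) (h₀ : IsReducedResolvent Z₀ P₀ R₀) :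
    (1 - P₀) * P = -(R₀ * (Z - Z₀) * P) := by
  rw [mul_assoc, sub_mul Z Z₀ P, h.gen_mul_proj, zero_sub, mul_neg, ← mul_assoc, h₀.res_mul_gen,
    neg_neg]

theorem proj_mul_compl (h : IsReducedResolvent Z P R) (h₀ : IsReducedResolvent Z₀ P₀ R₀) :
    P₀ * (1 - P) = P₀ * (Z - Z₀) * R := by
  rw [mul_sub P₀ Z Z₀, h₀.proj_mul_gen, sub_zero, mul_assoc, h.gen_mul_res]

theorem proj_sub_proj (h : IsReducedResolvent Z P R) (h₀ : IsReducedResolvent Z₀ P₀ R₀) :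
    P - P₀ = -(R₀ * (Z - Z₀) * P + P₀ * (Z - Z₀) * R) := by
  rw [neg_add, ← h.compl_mul_proj h₀, ← h.proj_mul_compl h₀]
  noncomm_ring

theorem res_sub_res (h : IsReducedResolvent Z P R) (h₀ : IsReducedResolvent Z₀ P₀ R₀) :
    R - R₀ = R * (R * (Z - Z₀) * P₀) + P * (Z - Z₀) * R₀ * R₀ - R * (Z - Z₀) * R₀ := by
  have hRRP : R * (Z - Z₀) * P₀ = (1 - P) * P₀ := by
    rw [mul_sub, sub_mul, mul_assoc R Z₀, h₀.gen_mul_proj, h.res_mul_gen, mul_zero, sub_zero]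
  have hPRR : P * (Z - Z₀) * R₀ = -(P * (1 - P₀)) := by
    rw [mul_sub, h.proj_mul_gen, zero_sub, neg_mul, mul_assoc, h₀.gen_mul_res]
  have hRR : R * (Z - Z₀) * R₀ = (1 - P) * R₀ - R * (1 - P₀) := by
    rw [mul_sub, sub_mul, h.res_mul_gen, mul_assoc, h₀.gen_mul_res]
  have hR : R * ((1 - P) * P₀) = R * P₀ := by
    rw [← mul_assoc, mul_sub, h.res_mul_proj, mul_one, sub_zero]
  have hR₀ : -(P * (1 - P₀)) * R₀ = -(P * R₀) := by
    rw [neg_mul, mul_assoc, sub_mul, h₀.proj_mul_res, one_mul, sub_zero]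
  rw [hRRP, hPRR, hRR, hR, hR₀]
  noncomm_ring

end Ring

section Perturbation

variable {A : Type*} [NormedRing A] {K : ℝ}

theorem norm_proj_sub_proj_le {Z P R Z₀ P₀ R₀ : A} (h : IsReducedResolvent Z P R)
    (h₀ : IsReducedResolvent Z₀ P₀ R₀) (hP : ‖P‖ ≤ K) (hR : ‖R‖ ≤ K) (hP₀ : ‖P₀‖ ≤ K)
    (hR₀ : ‖R₀‖ ≤ K) : ‖P - P₀‖ ≤ 2 * K ^ 2 * ‖Z - Z₀‖ := by
  have hK : 0 ≤ K := (norm_nonneg P).trans hP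
  rw [h.proj_sub_proj h₀, norm_neg]
  calc ‖R₀ * (Z - Z₀) * P + P₀ * (Z - Z₀) * R‖
      ≤ ‖R₀‖ * ‖Z - Z₀‖ * ‖P‖ + ‖P₀‖ * ‖Z - Z₀‖ * ‖R‖ := norm_add_le_of_le norm_mul₃_le norm_mul₃_le
    _ ≤ K * ‖Z - Z₀‖ * K + K * ‖Z - Z₀‖ * K := by gcongr
    _ = 2 * K ^ 2 * ‖Z - Z₀‖ := by ring

theorem norm_res_sub_res_le {Z P R Z₀ P₀ R₀ : A} (h : IsReducedResolvent Z P R)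
    (h₀ : IsReducedResolvent Z₀ P₀ R₀) (hP : ‖P‖ ≤ K) (hR : ‖R‖ ≤ K) (hP₀ : ‖P₀‖ ≤ K)
    (hR₀ : ‖R₀‖ ≤ K) : ‖R - R₀‖ ≤ (2 * K ^ 3 + K ^ 2) * ‖Z - Z₀‖ := by
  have hK : 0 ≤ K := (norm_nonneg P).trans hP
  rw [h.res_sub_res h₀]
  calc ‖R * (R * (Z - Z₀) * P₀) + P * (Z - Z₀) * R₀ * R₀ - R * (Z - Z₀) * R₀‖
      ≤ ‖R‖ * (‖R‖ * ‖Z - Z₀‖ * ‖P₀‖) + ‖P‖ * ‖Z - Z₀‖ * ‖R₀‖ * ‖R₀‖ + ‖R‖ * ‖Z - Z₀‖ * ‖R₀‖ :=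
        norm_sub_le_of_le (norm_add_le_of_le (norm_mul_le_of_le le_rfl norm_mul₃_le)
          (norm_mul_le_of_le norm_mul₃_le le_rfl)) norm_mul₃_le
    _ ≤ K * (K * ‖Z - Z₀‖ * K) + K * ‖Z - Z₀‖ * K * K + K * ‖Z - Z₀‖ * K := by gcongr
    _ = (2 * K ^ 3 + K ^ 2) * ‖Z - Z₀‖ := by ring

variable {I : Set ℝ} {s₀ : ℝ} {Z P R : ℝ → A}

theorem continuousWithinAt_proj (hres : ∀ s ∈ I, IsReducedResolvent (Z s) (P s) (R s))
    (hP : ∀ s ∈ I, ‖P s‖ ≤ K) (hR : ∀ s ∈ I, ‖R s‖ ≤ K) (hZ : ContinuousWithinAt Z I s₀)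
    (hs₀ : s₀ ∈ I) : ContinuousWithinAt P I s₀ := by
  refine tendsto_iff_norm_sub_tendsto_zero.2 <| squeeze_zero' (.of_forall fun _ => norm_nonneg _)
    (?_ : ∀ᶠ s in 𝓝[I] s₀, _ ≤ 2 * K ^ 2 * ‖Z s - Z s₀‖) ?_
  · filter_upwards [self_mem_nhdsWithin] with s hs
    exact (hres s hs).norm_proj_sub_proj_le (hres s₀ hs₀) (hP s hs) (hR s hs) (hP s₀ hs₀)
      (hR s₀ hs₀)
  · simpa using (tendsto_iff_norm_sub_tendsto_zero.1 hZ).const_mul (2 * K ^ 2)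

theorem continuousWithinAt_res (hres : ∀ s ∈ I, IsReducedResolvent (Z s) (P s) (R s))
    (hP : ∀ s ∈ I, ‖P s‖ ≤ K) (hR : ∀ s ∈ I, ‖R s‖ ≤ K) (hZ : ContinuousWithinAt Z I s₀)
    (hs₀ : s₀ ∈ I) : ContinuousWithinAt R I s₀ := by
  refine tendsto_iff_norm_sub_tendsto_zero.2 <| squeeze_zero' (.of_forall fun _ => norm_nonneg _)
    (?_ : ∀ᶠ s in 𝓝[I] s₀, _ ≤ (2 * K ^ 3 + K ^ 2) * ‖Z s - Z s₀‖) ?_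
  · filter_upwards [self_mem_nhdsWithin] with s hs
    exact (hres s hs).norm_res_sub_res_le (hres s₀ hs₀) (hP s hs) (hR s hs) (hP s₀ hs₀)
      (hR s₀ hs₀)
  · simpa using (tendsto_iff_norm_sub_tendsto_zero.1 hZ).const_mul (2 * K ^ 3 + K ^ 2)

variable [NormedAlgebra ℝ A] {z : A}

theorem hasDerivWithinAt_proj (hres : ∀ s ∈ I, IsReducedResolvent (Z s) (P s) (R s))
    (hP : ∀ s ∈ I, ‖P s‖ ≤ K) (hR : ∀ s ∈ I, ‖R s‖ ≤ K) (hZ : HasDerivWithinAt Z z I s₀)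
    (hs₀ : s₀ ∈ I) : HasDerivWithinAt P (-(R s₀ * z * P s₀ + P s₀ * z * R s₀)) I s₀ := by
  have hmono : 𝓝[I \ {s₀}] s₀ ≤ 𝓝[I] s₀ := nhdsWithin_mono _ sdiff_subset
  have tP := (continuousWithinAt_proj hres hP hR hZ.continuousWithinAt hs₀).tendsto.mono_left hmono
  have tR := (continuousWithinAt_res hres hP hR hZ.continuousWithinAt hs₀).tendsto.mono_left hmono
  have tZ := hasDerivWithinAt_iff_tendsto_slope.1 hZ
  refine hasDerivWithinAt_iff_tendsto_slope.2 <| Tendsto.congr' ?_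
    (((tZ.const_mul (R s₀)).mul tP).add ((tZ.const_mul (P s₀)).mul tR)).neg
  filter_upwards [hmono self_mem_nhdsWithin] with s hs
  simp only [slope_def_module, (hres s hs).proj_sub_proj (hres s₀ hs₀), mul_smul_comm,
    smul_mul_assoc, smul_neg, smul_add]

theorem hasDerivWithinAt_res (hres : ∀ s ∈ I, IsReducedResolvent (Z s) (P s) (R s))
    (hP : ∀ s ∈ I, ‖P s‖ ≤ K) (hR : ∀ s ∈ I, ‖R s‖ ≤ K) (hZ : HasDerivWithinAt Z z I s₀)
    (hs₀ : s₀ ∈ I) :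
    HasDerivWithinAt R (R s₀ * (R s₀ * z * P s₀) + P s₀ * z * R s₀ * R s₀ - R s₀ * z * R s₀)
      I s₀ := by
  have hmono : 𝓝[I \ {s₀}] s₀ ≤ 𝓝[I] s₀ := nhdsWithin_mono _ sdiff_subset
  have tP := (continuousWithinAt_proj hres hP hR hZ.continuousWithinAt hs₀).tendsto.mono_left hmono
  have tR := (continuousWithinAt_res hres hP hR hZ.continuousWithinAt hs₀).tendsto.mono_left hmono
  have tZ := hasDerivWithinAt_iff_tendsto_slope.1 hZ
  refine hasDerivWithinAt_iff_tendsto_slope.2 <| Tendsto.congr' ?_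
    (((tR.mul ((tR.mul tZ).mul_const (P s₀))).add
      (((tP.mul tZ).mul_const (R s₀)).mul_const (R s₀))).sub ((tR.mul tZ).mul_const (R s₀)))
  filter_upwards [hmono self_mem_nhdsWithin] with s hs
  simp only [slope_def_module, (hres s hs).res_sub_res (hres s₀ hs₀), mul_smul_comm,
    smul_mul_assoc, ← smul_add, ← smul_sub]

end Perturbation

end IsReducedResolvent

/-- The Hellmann–Feynman formula; `τ` plays the role of the trace. -/
theorem hasDerivWithinAt_eigenvalue {A : Type*} [NormedRing A] [NormedAlgebra ℝ A] {I : Set ℝ}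
    {H P : ℝ → A} {E : ℝ → ℝ} {h : A} {s₀ : ℝ} {τ : A →L[ℝ] ℝ}
    (hHP : ∀ s ∈ I, H s * P s = E s • P s) (hPH : P s₀ * H s₀ = E s₀ • P s₀)
    (hP : P s₀ * P s₀ = P s₀) (hτ : τ (P s₀) = 1) (cP : ContinuousWithinAt P I s₀)
    (hH : HasDerivWithinAt H h I s₀) :
    HasDerivWithinAt E (τ (P s₀ * h * P s₀)) I s₀ := by
  have hmono : 𝓝[I \ {s₀}] s₀ ≤ 𝓝[I] s₀ := nhdsWithin_mono _ sdiff_subset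
  have tP := cP.tendsto.mono_left hmono
  have tτ : Tendsto (fun s => τ (P s₀ * P s)) (𝓝[I \ {s₀}] s₀) (𝓝 1) := by
    have := (τ.continuous.tendsto _).comp (tP.const_mul (P s₀))
    rwa [hP, hτ] at this
  have tH := (τ.continuous.tendsto _).comp
    (((hasDerivWithinAt_iff_tendsto_slope.1 hH).const_mul (P s₀)).mul tP)
  rw [hasDerivWithinAt_iff_tendsto_slope, ← div_one (τ _)]
  refine (tH.div tτ one_ne_zero).congr' ?_
  filter_upwards [hmono self_mem_nhdsWithin, tτ.eventually_ne one_ne_zero] with s hs hne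
  have hsub : P s₀ * (H s - H s₀) * P s = (E s - E s₀) • (P s₀ * P s) := by
    rw [mul_sub, sub_mul, mul_assoc, hHP s hs, hPH, mul_smul_comm, smul_mul_assoc, sub_smul]
  rw [Pi.div_apply, Function.comp_apply, div_eq_iff hne, slope_def_module, slope_def_module,
    mul_smul_comm, smul_mul_assoc, hsub, smul_smul, map_smul, smul_eq_mul, smul_eq_mul]

theorem exists_isLittleO_le_add {α : Type*} {l : Filter α} {f g φ : α → ℝ}
    (hφ : ∀ᶠ x in l, 0 ≤ φ x) (h : ∀ ε > 0, ∀ᶠ x in l, f x ≤ g x + ε * φ x) :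
    ∃ r : α → ℝ, r =o[l] φ ∧ ∀ x, f x ≤ g x + r x := by
  refine ⟨fun x => max 0 (f x - g x), isLittleO_iff.2 fun ε hε => ?_,
    fun x => sub_le_iff_le_add'.1 (le_max_right _ _)⟩
  filter_upwards [hφ, h ε hε] with x hx hle
  rw [Real.norm_of_nonneg (le_max_left _ _), Real.norm_of_nonneg hx]
  exact max_le (by positivity) (sub_le_iff_le_add'.2 hle)

/-- The filter of the limit `T → ∞`, uniformly in `s ∈ [0,1]`. -/
def unifAtTop : Filter (ℝ × ℝ) := atTop ×ˢ 𝓟 (Icc 0 1)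

theorem tendsto_fst_unifAtTop : Tendsto Prod.fst unifAtTop atTop := tendsto_fst

theorem eventually_unifAtTop {p : ℝ × ℝ → Prop} :
    (∀ᶠ x in unifAtTop, p x) ↔ ∀ᶠ T in atTop, ∀ s ∈ Icc (0 : ℝ) 1, p (T, s) :=
  eventually_prod_principal_iff

theorem one_isLittleO_sqrt_unifAtTop : (fun _ => (1 : ℝ)) =o[unifAtTop] fun x => √x.1 :=
  (isLittleO_one_left_iff ℝ).2 <|
    tendsto_norm_atTop_atTop.comp (Real.tendsto_sqrt_atTop.comp tendsto_fst_unifAtTop)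

section Symbols

variable {E F : Type*} [NormedAddCommGroup E] [NormedAddCommGroup F] {m k n : ℕ} {f g : ℝ → ℝ → E}

/-- `f T s` is of order `m` in `√T` uniformly in `s ∈ [0,1]`: it is `O(1)` for `m = 0` and
`o(√T ^ m)` for `m > 0`. -/
structure HasOrder (m : ℕ) (f : ℝ → ℝ → E) : Prop where
  isBigO : (fun x : ℝ × ℝ => f x.1 x.2) =O[unifAtTop] fun x => √x.1 ^ m
  isLittleO : 0 < m → (fun x : ℝ × ℝ => f x.1 x.2) =o[unifAtTop] fun x => √x.1 ^ m

namespace HasOrder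

theorem of_isLittleO
    (hf : (fun x : ℝ × ℝ => f x.1 x.2) =o[unifAtTop] fun x => √x.1 ^ m) : HasOrder m f :=
  ⟨hf.isBigO, fun _ => hf⟩

theorem zero_of_bounded {b : ℝ} (hf : ∀ T > 0, ∀ s ∈ Icc (0 : ℝ) 1, ‖f T s‖ ≤ b) :
    HasOrder 0 f := by
  refine ⟨IsBigO.of_bound b (eventually_unifAtTop.2 ?_), fun h => absurd h (lt_irrefl 0)⟩
  filter_upwards [eventually_gt_atTop 0] with T hT s hs
  simpa using hf T hT s hs

theorem succ (hf : HasOrder m f) : HasOrder (m + 1) f :=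
  of_isLittleO <| hf.isBigO.trans_isLittleO <| by
    simpa only [pow_succ, mul_one] using
      (isBigO_refl (fun x : ℝ × ℝ => √x.1 ^ m) unifAtTop).mul_isLittleO one_isLittleO_sqrt_unifAtTop

theorem add (hf : HasOrder m f) (hg : HasOrder m g) : HasOrder m (f + g) :=
  ⟨hf.isBigO.add hg.isBigO, fun hm => (hf.isLittleO hm).add (hg.isLittleO hm)⟩

theorem map [NormedSpace ℝ E] [NormedSpace ℝ F] (L : E →L[ℝ] F) (hf : HasOrder m f) :
    HasOrder m fun T s => L (f T s) :=
  ⟨(L.isBigO_comp _ _).trans hf.isBigO,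
    fun hm => (L.isBigO_comp _ _).trans_isLittleO (hf.isLittleO hm)⟩

theorem mul {A : Type*} [NormedRing A] {f g : ℝ → ℝ → A} (hf : HasOrder m f)
    (hg : HasOrder k g) : HasOrder (m + k) (f * g) := by
  refine ⟨?_, fun h => ?_⟩ <;> simp only [Pi.mul_apply, pow_add]
  · exact hf.isBigO.mul hg.isBigO
  · rcases Nat.add_pos_iff_pos_or_pos.1 h with hm | hk
    · exact (hf.isLittleO hm).mul_isBigO hg.isBigO
    · exact hf.isBigO.mul_isLittleO (hg.isLittleO hk)

end HasOrder

variable [NormedSpace ℝ E] [NormedSpace ℝ F]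

/-- `f' T` is the derivative of `f T` on `[0,1]`, for every `T > 0`. -/
def HasDerivOnUnit (f f' : ℝ → ℝ → E) : Prop :=
  ∀ T > 0, ∀ s ∈ Icc (0 : ℝ) 1, HasDerivWithinAt (f T) (f' T s) (Icc 0 1) s

/-- `f T` is `n` times differentiable on `[0,1]` and its derivative of order `j ≤ n` has order
`m + j`: each differentiation costs a factor `√T`. -/
def IsSymbol : ℕ → ℕ → (ℝ → ℝ → E) → Prop
  | 0, m, f => HasOrder m f
  | n + 1, m, f => HasOrder m f ∧ ∃ f', HasDerivOnUnit f f' ∧ IsSymbol n (m + 1) f'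

namespace HasDerivOnUnit

variable {f' g' : ℝ → ℝ → E}

theorem add (hf : HasDerivOnUnit f f') (hg : HasDerivOnUnit g g') :
    HasDerivOnUnit (f + g) (f' + g') :=
  fun T hT s hs => (hf T hT s hs).add (hg T hT s hs)

theorem map (L : E →L[ℝ] F) (hf : HasDerivOnUnit f f') :
    HasDerivOnUnit (fun T s => L (f T s)) fun T s => L (f' T s) :=
  fun T hT s hs => L.hasFDerivAt.comp_hasDerivWithinAt s (hf T hT s hs)

theorem mul {A : Type*} [NormedRing A] [NormedAlgebra ℝ A] {f g f' g' : ℝ → ℝ → A}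
    (hf : HasDerivOnUnit f f') (hg : HasDerivOnUnit g g') :
    HasDerivOnUnit (f * g) (f' * g + f * g') :=
  fun T hT s hs => (hf T hT s hs).mul (hg T hT s hs)

theorem eq_of_eqOn (hf : HasDerivOnUnit f f') (hg : HasDerivOnUnit g g')
    (hfg : ∀ T > 0, EqOn (f T) (g T) (Icc 0 1)) : ∀ T > 0, EqOn (f' T) (g' T) (Icc 0 1) :=
  fun T hT s hs => (uniqueDiffOn_Icc zero_lt_one s hs).eq_deriv _ (hf T hT s hs)
    ((hg T hT s hs).congr (hfg T hT) (hfg T hT hs))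

end HasDerivOnUnit

namespace IsSymbol

theorem hasOrder (hf : IsSymbol n m f) : HasOrder m f :=
  match n, hf with
  | 0, hf => hf
  | _ + 1, hf => hf.1

theorem of_succ (hf : IsSymbol (n + 1) m f) : IsSymbol n m f := by
  induction n generalizing m f with
  | zero => exact hf.hasOrder
  | succ n ih =>
    obtain ⟨hm, f', hf', hs⟩ := hf
    exact ⟨hm, f', hf', ih hs⟩

theorem order_succ (hf : IsSymbol n m f) : IsSymbol n (m + 1) f := by
  induction n generalizing m f with
  | zero => exact HasOrder.succ hf
  | succ n ih =>
    obtain ⟨hm, f', hf', hs⟩ := hf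
    exact ⟨hm.succ, f', hf', ih hs⟩

theorem add (hf : IsSymbol n m f) (hg : IsSymbol n m g) : IsSymbol n m (f + g) := by
  induction n generalizing m f g with
  | zero => exact HasOrder.add hf hg
  | succ n ih =>
    obtain ⟨hfm, f', hf', hfs⟩ := hf
    obtain ⟨hgm, g', hg', hgs⟩ := hg
    exact ⟨hfm.add hgm, _, hf'.add hg', ih hfs hgs⟩

theorem map (L : E →L[ℝ] F) (hf : IsSymbol n m f) : IsSymbol n m fun T s => L (f T s) := by
  induction n generalizing m f with
  | zero => exact HasOrder.map L hf
  | succ n ih =>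
    obtain ⟨hm, f', hf', hs⟩ := hf
    exact ⟨hm.map L, _, hf'.map L, ih hs⟩

theorem neg (hf : IsSymbol n m f) : IsSymbol n m (-f) :=
  hf.map (-ContinuousLinearMap.id ℝ E)

theorem sub (hf : IsSymbol n m f) (hg : IsSymbol n m g) : IsSymbol n m (f - g) := by
  simpa only [sub_eq_add_neg] using hf.add hg.neg

theorem const_smul {E : Type*} [NormedAddCommGroup E] [NormedSpace ℂ E] {f : ℝ → ℝ → E} (c : ℂ)
    (hf : IsSymbol n m f) : IsSymbol n m (c • f) :=
  hf.map (ContinuousLinearMap.lsmul ℝ ℂ c)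

section Ring

variable {A : Type*} [NormedRing A] [NormedAlgebra ℝ A]

theorem mul {f g : ℝ → ℝ → A} (hf : IsSymbol n m f) (hg : IsSymbol n k g) :
    IsSymbol n (m + k) (f * g) := by
  induction n generalizing m k f g with
  | zero => exact HasOrder.mul hf hg
  | succ n ih =>
    have hf₀ := hf.of_succ
    have hg₀ := hg.of_succ
    obtain ⟨hfm, f', hf', hfs⟩ := hf
    obtain ⟨hgm, g', hg', hgs⟩ := hg
    refine ⟨hfm.mul hgm, _, hf'.mul hg', ?_⟩
    have hfg := ih hfs hg₀
    rw [Nat.add_right_comm] at hfg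
    exact hfg.add (ih (k := k + 1) hf₀ hgs)

variable {P R h : ℝ → ℝ → A} (L : A →L[ℝ] A)

theorem sub_map_compression (hP : IsSymbol n 0 P) (hh : IsSymbol n 0 h) :
    IsSymbol n 0 (h - fun T s => L ((P * h * P) T s)) :=
  hh.sub (((hP.mul hh).mul hP).map L)

-- The right-hand sides involve `P`, `R` and `h` only, so their regularity bootstraps.
theorem proj_and_res (hP : HasOrder 0 P) (hR : HasOrder 0 R) {z : ℝ → ℝ → A}
    (hz : z = h - fun T s => L ((P * h * P) T s))
    (dP : HasDerivOnUnit P (-(R * z * P + P * z * R)))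
    (dR : HasDerivOnUnit R (R * (R * z * P) + P * z * R * R - R * z * R))
    (hh : IsSymbol n 0 h) : IsSymbol n 0 P ∧ IsSymbol n 0 R := by
  induction n with
  | zero => exact ⟨hP, hR⟩
  | succ n ih =>
    obtain ⟨hPn, hRn⟩ := ih hh.of_succ
    have hzn : IsSymbol n 0 z := hz ▸ hPn.sub_map_compression L hh.of_succ
    have hRzP := (hRn.mul hzn).mul hPn
    have hPzR := (hPn.mul hzn).mul hRn
    exact ⟨⟨hP, _, dP, (hRzP.add hPzR).neg.order_succ⟩,
      ⟨hR, _, dR, (((hRn.mul hRzP).add (hPzR.mul hRn)).sub ((hRn.mul hzn).mul hRn)).order_succ⟩⟩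

end Ring

end IsSymbol

end Symbols

section SuperadiabaticAlgebra

variable {A : Type*} [Ring A] {Z P R D : A}

theorem commutator_mul_self_of_offDiagonal (hP : P * P = P) (hZP : Z * P = 0) (hPZ : P * Z = 0)
    (hD : P * D + D * P = D) : Z * (D * D) - D * D * Z = Z * (D * P * D) - D * P * D * Z := by
  have hDP : (1 - P) * D = D * P := by
    rw [sub_mul, one_mul, sub_eq_iff_eq_add', hD]
  have hPD : D * (1 - P) = P * D := by
    rw [mul_sub, mul_one, sub_eq_iff_eq_add, hD]
  have hblock : D * D = D * P * D + P * (D * D) * P :=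
    calc D * D = D * P * D + D * ((1 - P) * (1 - P)) * D := by
          simp only [sub_mul, mul_sub, one_mul, mul_one, hP]
          noncomm_ring
      _ = D * P * D + D * (1 - P) * ((1 - P) * D) := by simp only [mul_assoc]
      _ = D * P * D + P * (D * D) * P := by simp only [hDP, hPD, mul_assoc]
  have hleft : Z * (P * (D * D) * P) = 0 := by
    rw [← mul_assoc, ← mul_assoc, hZP, zero_mul, zero_mul]
  have hright : P * (D * D) * P * Z = 0 := by rw [mul_assoc, hPZ, mul_zero]
  rw [hblock, mul_add, add_mul, hleft, hright, add_zero, add_zero]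

variable [Algebra ℂ A]

/-- The inverse of the Liouvillian `X ↦ I • [Z, X]` on operators which are off-diagonal with respect
to the spectral projection `P` of `Z`, where `R` is the reduced resolvent of `Z`. -/
noncomputable def liouvillianInv (P R Y : A) : A := Complex.I • (P * Y * R - R * Y * P)

/-- The coefficient of `T⁻¹` in the superadiabatic projection, where `z` is the derivative of the
generator. -/
noncomputable def firstCorrection (P R z : A) : A := liouvillianInv P R (R * z * P + P * z * R)

/-- The coefficient of `T⁻²` in the superadiabatic projection, where `D'` is the derivative of the
first coefficient `D`. -/
noncomputable def secondCorrection (P R D D' : A) : A := D * P * D - liouvillianInv P R D'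

namespace IsReducedResolvent

theorem commutator_liouvillianInv (h : IsReducedResolvent Z P R) (Y : A) :
    Complex.I • (Z * liouvillianInv P R Y - liouvillianInv P R Y * Z) =
      (1 - P) * Y * P + P * Y * (1 - P) := by
  have hleft : Z * (P * Y * R - R * Y * P) = -((1 - P) * Y * P) := by
    simp only [mul_sub, ← mul_assoc, h.gen_mul_proj, h.gen_mul_res, zero_mul, zero_sub]
  have hright : (P * Y * R - R * Y * P) * Z = P * Y * (1 - P) := by
    simp only [sub_mul, mul_assoc, h.res_mul_gen, h.proj_mul_gen, mul_zero, sub_zero]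
  rw [liouvillianInv, mul_smul_comm, smul_mul_assoc, ← smul_sub, smul_smul, Complex.I_mul_I, hleft,
    hright, neg_one_smul]
  abel

theorem firstCorrection_eq (h : IsReducedResolvent Z P R) (z : A) :
    firstCorrection P R z = Complex.I • (P * z * R * R - R * (R * z * P)) := by
  simp only [firstCorrection, liouvillianInv, mul_add, add_mul, ← mul_assoc, h.proj_mul_res,
    h.proj_mul_proj, zero_mul, zero_add]
  simp only [mul_assoc, h.res_mul_proj, h.proj_mul_proj, mul_zero, add_zero]

theorem firstCorrection_mul_proj (h : IsReducedResolvent Z P R) (z : A) :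
    firstCorrection P R z * P = -(Complex.I • (R * (R * z * P))) := by
  simp only [h.firstCorrection_eq, smul_mul_assoc, sub_mul, mul_assoc, h.res_mul_proj,
    h.proj_mul_proj, mul_zero, zero_sub, smul_neg]

theorem compl_mul_firstCorrection (h : IsReducedResolvent Z P R) (z : A) :
    (1 - P) * firstCorrection P R z = -(Complex.I • (R * (R * z * P))) := by
  simp only [h.firstCorrection_eq, mul_smul_comm, mul_sub, sub_mul, one_mul, ← mul_assoc,
    h.proj_mul_res, h.proj_mul_proj, zero_mul, sub_self, sub_zero, zero_sub, smul_neg]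

theorem firstCorrection_offDiagonal (h : IsReducedResolvent Z P R) (z : A) :
    P * firstCorrection P R z + firstCorrection P R z * P = firstCorrection P R z := by
  rw [h.firstCorrection_mul_proj, ← h.compl_mul_firstCorrection, sub_mul, one_mul,
    add_sub_cancel]

theorem commutator_firstCorrection (h : IsReducedResolvent Z P R) (z : A) :
    -(Complex.I • (Z * firstCorrection P R z - firstCorrection P R z * Z)) =
      -(R * z * P + P * z * R) := by
  rw [firstCorrection, h.commutator_liouvillianInv]
  simp only [sub_mul, mul_sub, one_mul, mul_one, mul_add, add_mul, ← mul_assoc, h.proj_mul_res,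
    h.proj_mul_proj, zero_mul]
  simp only [mul_assoc, h.res_mul_proj, h.proj_mul_proj, mul_zero, add_zero, zero_add, sub_zero]

end IsReducedResolvent

theorem IsReducedResolvent.commutator_secondCorrection (h : IsReducedResolvent Z P R) {D' : A}
    (hD : P * D + D * P = D)
    (hD' : -(Complex.I • (Z * D - D * Z)) * D + P * D' +
      (D' * P + D * -(Complex.I • (Z * D - D * Z))) = D') :
    -(Complex.I • (Z * secondCorrection P R D D' - secondCorrection P R D D' * Z)) = D' := by
  have hsplit : D' = P * D' + D' * P - Complex.I • (Z * (D * D) - D * D * Z) := by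
    nth_rw 1 [← hD']
    simp only [neg_mul, mul_neg, smul_mul_assoc, mul_smul_comm, sub_mul, mul_sub, mul_assoc]
    module
  have hPD'P : P * D' * P = 0 := by
    have hP := congr(P * $hsplit * P)
    simp only [mul_sub, sub_mul, mul_add, add_mul, mul_smul_comm, smul_mul_assoc, ← mul_assoc,
      h.proj_mul_proj, h.proj_mul_gen, zero_mul] at hP
    simpa only [mul_assoc, h.proj_mul_proj, h.gen_mul_proj, mul_zero, sub_zero, smul_zero,
      left_eq_add] using hP
  have hoff : (1 - P) * D' * P + P * D' * (1 - P) = P * D' + D' * P := by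
    rw [sub_mul, sub_mul, hPD'P, mul_sub, hPD'P, one_mul, mul_one, sub_zero, sub_zero, add_comm]
  calc -(Complex.I • (Z * secondCorrection P R D D' - secondCorrection P R D D' * Z))
      = Complex.I • (Z * liouvillianInv P R D' - liouvillianInv P R D' * Z) -
          Complex.I • (Z * (D * P * D) - D * P * D * Z) := by
        rw [secondCorrection, mul_sub, sub_mul]
        module
    _ = D' := by
        rw [h.commutator_liouvillianInv, hoff, ← commutator_mul_self_of_offDiagonal h.proj_mul_proj
          h.gen_mul_proj h.proj_mul_gen hD, ← hsplit]

end SuperadiabaticAlgebra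

section SuperadiabaticFamily

variable {A : Type*} [NormedRing A] [NormedAlgebra ℂ A] {P R D D' Y Z z : ℝ → ℝ → A} {m n : ℕ}

namespace IsSymbol

theorem liouvillianInv (hP : IsSymbol n 0 P) (hR : IsSymbol n 0 R) (hY : IsSymbol n m Y) :
    IsSymbol n m (liouvillianInv P R Y) := by
  have hPYR := (hP.mul hY).mul hR
  have hRYP := (hR.mul hY).mul hP
  rw [Nat.zero_add] at hPYR hRYP
  exact (hPYR.sub hRYP).const_smul Complex.I

theorem firstCorrection (hP : IsSymbol n 0 P) (hR : IsSymbol n 0 R) (hz : IsSymbol n 0 z) :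
    IsSymbol n 0 (firstCorrection P R z) :=
  liouvillianInv hP hR (((hR.mul hz).mul hP).add ((hP.mul hz).mul hR))

theorem secondCorrection (hP : IsSymbol n 0 P) (hR : IsSymbol n 0 R) (hD : IsSymbol n 0 D)
    (hD' : IsSymbol n 1 D') : IsSymbol n 1 (secondCorrection P R D D') :=
  ((hD.mul hP).mul hD).order_succ.sub (liouvillianInv hP hR hD')

end IsSymbol

theorem exists_hasDerivOnUnit_firstCorrection_eq_commutator
    (hres : ∀ T > 0, ∀ s ∈ Icc (0 : ℝ) 1, IsReducedResolvent (Z T s) (P T s) (R T s))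
    (hP : IsSymbol 2 0 P) (hR : IsSymbol 2 0 R) (hz : IsSymbol 2 0 z)
    (dP : HasDerivOnUnit P (-(R * z * P + P * z * R))) :
    ∃ F, IsSymbol 1 1 F ∧ HasDerivOnUnit (firstCorrection P R z)
      (-(Complex.I • (Z * F - F * Z))) := by
  have hD := hP.firstCorrection hR hz
  set D := firstCorrection P R z
  have hD₁ := hD.of_succ
  obtain ⟨-, D', dD, hD'⟩ := hD
  have hoff : ∀ T > 0, ∀ s ∈ Icc (0 : ℝ) 1, P T s * D T s + D T s * P T s = D T s :=
    fun T hT s hs => (hres T hT s hs).firstCorrection_offDiagonal (z T s)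
  have hLeibniz := ((dP.mul dD).add (dD.mul dP)).eq_of_eqOn dD hoff
  refine ⟨secondCorrection P R D D', hP.of_succ.secondCorrection hR.of_succ hD₁ hD',
    fun T hT s hs => ?_⟩
  have hPT : -(Complex.I • (Z T s * D T s - D T s * Z T s)) =
      -(R T s * z T s * P T s + P T s * z T s * R T s) :=
    (hres T hT s hs).commutator_firstCorrection (z T s)
  have hD'T : -(Complex.I • (Z * secondCorrection P R D D' - secondCorrection P R D D' * Z)) T s =
      D' T s :=
    (hres T hT s hs).commutator_secondCorrection (hoff T hT s hs) (hPT ▸ hLeibniz T hT hs)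
  have := dD T hT s hs
  rwa [← hD'T] at this

end SuperadiabaticFamily

section Evolution

variable {A : Type*} [NormedRing A] [StarRing A] [CStarRing A] {T ε : ℝ}

theorem norm_compl_mul_unitary_mul_le {u P₀ P₁ X₀ X₁ : A} (hu : u ∈ unitary A)
    (hP₀ : IsStarProjection P₀) (hP₁ : IsStarProjection P₁)
    (hW : ‖(P₁ + X₁) * u - u * (P₀ + X₀)‖ ≤ ε) :
    ‖(1 - P₁) * u * P₀‖ ≤ ‖(1 - P₁) * X₁‖ + ‖X₀ * P₀‖ + ε := by
  set Q₁ := 1 - P₁ with hQ₁def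
  set W := (P₁ + X₁) * u - u * (P₀ + X₀) with hWdef
  have hQ₁ : ‖Q₁‖ ≤ 1 := hP₁.one_sub.norm_le
  have hQP : Q₁ * P₁ = 0 := by rw [hQ₁def, sub_mul, one_mul, hP₁.isIdempotentElem.eq, sub_self]
  have hsplit : Q₁ * u * P₀ = Q₁ * X₁ * u * P₀ - Q₁ * (u * (X₀ * P₀)) - Q₁ * W * P₀ := by
    have hW₁ : Q₁ * (P₁ + X₁) = Q₁ * X₁ := by rw [mul_add, hQP, zero_add]
    have hW₀ : (P₀ + X₀) * P₀ = P₀ + X₀ * P₀ := by rw [add_mul, hP₀.isIdempotentElem.eq]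
    have hQWP : Q₁ * W * P₀ = Q₁ * (P₁ + X₁) * u * P₀ - Q₁ * u * ((P₀ + X₀) * P₀) := by
      rw [hWdef]
      noncomm_ring
    rw [hQWP, hW₁, hW₀]
    noncomm_ring
  have hX₁ : ‖Q₁ * X₁ * u * P₀‖ ≤ ‖Q₁ * X₁‖ :=
    (norm_mul_le_of_le (CStarRing.norm_mul_mem_unitary _ hu).le hP₀.norm_le).trans_eq (mul_one _)
  have hX₀ : ‖Q₁ * (u * (X₀ * P₀))‖ ≤ ‖X₀ * P₀‖ :=
    (norm_mul_le_of_le hQ₁ (CStarRing.norm_mem_unitary_mul _ hu).le).trans_eq (one_mul _)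
  have hQWP : ‖Q₁ * W * P₀‖ ≤ ε :=
    (norm_mul_le_of_le (norm_mul_le_of_le hQ₁ hW) hP₀.norm_le).trans_eq (by ring)
  rw [hsplit]
  exact norm_sub_le_of_le (norm_sub_le_of_le hX₁ hX₀) hQWP

theorem superadiabatic_residual {A : Type*} [Ring A] [Algebra ℂ A] {H P D F F' : A} (hT : T ≠ 0)
    (hHP : H * P = P * H) :
    -(Complex.I • (H * D - D * H)) + (T : ℂ)⁻¹ • -(Complex.I • (H * F - F * H)) +
        (T : ℂ)⁻¹ ^ 2 • F' + (Complex.I * T) • (H * (P + (T : ℂ)⁻¹ • D + (T : ℂ)⁻¹ ^ 2 • F) -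
          (P + (T : ℂ)⁻¹ • D + (T : ℂ)⁻¹ ^ 2 • F) * H) = (T : ℂ)⁻¹ ^ 2 • F' := by
  have hT' : (T : ℂ) ≠ 0 := Complex.ofReal_ne_zero.2 hT
  simp only [mul_add, add_mul, mul_smul_comm, smul_mul_assoc, hHP]
  match_scalars <;> field_simp <;> ring

variable [NormedAlgebra ℂ A] [StarModule ℂ A] {H U : ℝ → A}

theorem star_mul_self_of_schrodinger (hH : ∀ s ∈ Icc (0 : ℝ) 1, IsSelfAdjoint (H s))
    (hU₀ : U 0 = 1)
    (hU : ∀ s ∈ Icc (0 : ℝ) 1,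
      HasDerivWithinAt U (-(Complex.I * (T : ℂ)) • (H s * U s)) (Icc 0 1) s) :
    ∀ s ∈ Icc (0 : ℝ) 1, star (U s) * U s = 1 := by
  have hderiv : ∀ s ∈ Icc (0 : ℝ) 1,
      HasDerivWithinAt (fun s => star (U s) * U s) 0 (Icc 0 1) s := by
    intro s hs
    convert (hU s hs).star.mul (hU s hs) using 1
    · rfl
    · simp [(hH s hs).star_eq, mul_assoc]
  intro s hs
  have := (convex_Icc (0 : ℝ) 1).norm_image_sub_le_of_norm_hasDerivWithin_le hderiv
    (C := 0) (fun _ _ => norm_zero.le) (left_mem_Icc.2 zero_le_one) hs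
  rw [zero_mul, norm_le_zero_iff, sub_eq_zero] at this
  simpa [hU₀] using this

theorem norm_intertwine_evolution_le {W W' : ℝ → A}
    (hH : ∀ s ∈ Icc (0 : ℝ) 1, IsSelfAdjoint (H s)) (hU₀ : U 0 = 1)
    (hU : ∀ s ∈ Icc (0 : ℝ) 1,
      HasDerivWithinAt U (-(Complex.I * (T : ℂ)) • (H s * U s)) (Icc 0 1) s)
    (hunit : ∀ s ∈ Icc (0 : ℝ) 1, U s ∈ unitary A)
    (hW : ∀ s ∈ Icc (0 : ℝ) 1, HasDerivWithinAt W (W' s) (Icc 0 1) s)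
    (hε : ∀ s ∈ Icc (0 : ℝ) 1,
      ‖W' s + (Complex.I * (T : ℂ)) • (H s * W s - W s * H s)‖ ≤ ε) :
    ‖W 1 * U 1 - U 1 * W 0‖ ≤ ε := by
  have hmem₁ : (1 : ℝ) ∈ Icc (0 : ℝ) 1 := right_mem_Icc.2 zero_le_one
  have hderiv : ∀ s ∈ Icc (0 : ℝ) 1, HasDerivWithinAt (fun s => star (U s) * W s * U s)
      (star (U s) * (W' s + (Complex.I * (T : ℂ)) • (H s * W s - W s * H s)) * U s)
      (Icc 0 1) s := by
    intro s hs
    convert ((hU s hs).star.mul (hW s hs)).mul (hU s hs) using 1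
    · rfl
    · simp only [star_smul, star_mul, (hH s hs).star_eq, star_neg, RCLike.star_def,
        Complex.conj_I, Complex.conj_ofReal, Pi.mul_apply, mul_add, add_mul, mul_sub, sub_mul,
        smul_mul_assoc, mul_smul_comm, mul_assoc, smul_sub]
      module
  have hconj : ‖star (U 1) * W 1 * U 1 - W 0‖ ≤ ε := by
    simpa [hU₀] using (convex_Icc (0 : ℝ) 1).norm_image_sub_le_of_norm_hasDerivWithin_le hderiv
      (fun s hs => ((CStarRing.norm_mul_mem_unitary _ (hunit s hs)).trans
        (CStarRing.norm_mem_unitary_mul _ (Unitary.star_mem (hunit s hs)))).trans_le (hε s hs))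
      (left_mem_Icc.2 zero_le_one) hmem₁
  rw [← CStarRing.norm_mem_unitary_mul _ (hunit 1 hmem₁)] at hconj
  rwa [mul_sub, ← mul_assoc, ← mul_assoc, Unitary.mul_star_self_of_mem (hunit 1 hmem₁),
    one_mul] at hconj

theorem norm_compl_mul_evolution_mul_proj_le {P D F F' : ℝ → A} {δ : ℝ} (hT : 0 < T)
    (hH : ∀ s ∈ Icc (0 : ℝ) 1, IsSelfAdjoint (H s)) (hU₀ : U 0 = 1)
    (hU : ∀ s ∈ Icc (0 : ℝ) 1,
      HasDerivWithinAt U (-(Complex.I * (T : ℂ)) • (H s * U s)) (Icc 0 1) s)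
    (hunit : ∀ s ∈ Icc (0 : ℝ) 1, U s ∈ unitary A)
    (hP : ∀ s ∈ Icc (0 : ℝ) 1, IsStarProjection (P s))
    (hHP : ∀ s ∈ Icc (0 : ℝ) 1, H s * P s = P s * H s)
    (dP : ∀ s ∈ Icc (0 : ℝ) 1,
      HasDerivWithinAt P (-(Complex.I • (H s * D s - D s * H s))) (Icc 0 1) s)
    (dD : ∀ s ∈ Icc (0 : ℝ) 1,
      HasDerivWithinAt D (-(Complex.I • (H s * F s - F s * H s))) (Icc 0 1) s)
    (dF : ∀ s ∈ Icc (0 : ℝ) 1, HasDerivWithinAt F (F' s) (Icc 0 1) s)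
    (hF : ∀ s ∈ Icc (0 : ℝ) 1, ‖F s‖ ≤ δ) (hF' : ∀ s ∈ Icc (0 : ℝ) 1, ‖F' s‖ ≤ δ) :
    ‖(1 - P 1) * U 1 * P 0‖ ≤
      T⁻¹ * (‖(1 - P 1) * D 1‖ + ‖D 0 * P 0‖) + 3 * (T⁻¹ ^ 2 * δ) := by
  have hmem₀ : (0 : ℝ) ∈ Icc (0 : ℝ) 1 := left_mem_Icc.2 zero_le_one
  have hmem₁ : (1 : ℝ) ∈ Icc (0 : ℝ) 1 := right_mem_Icc.2 zero_le_one
  have hnorm : ‖(T : ℂ)⁻¹‖ = T⁻¹ := by rw [norm_inv, Complex.norm_of_nonneg hT.le]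
  have hnorm₂ {x : A} (hx : ‖x‖ ≤ δ) : ‖(T : ℂ)⁻¹ ^ 2 • x‖ ≤ T⁻¹ ^ 2 * δ := by
    rw [norm_smul, norm_pow, hnorm]
    gcongr
  have hW := norm_intertwine_evolution_le (ε := T⁻¹ ^ 2 * δ) hH hU₀ hU hunit
    (fun s hs => ((dP s hs).add ((dD s hs).const_smul (T : ℂ)⁻¹)).add
      ((dF s hs).const_smul ((T : ℂ)⁻¹ ^ 2))) fun s hs => by
    simp only [Pi.add_apply, Pi.smul_apply]
    rw [superadiabatic_residual hT.ne' (hHP s hs)]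
    exact hnorm₂ (hF' s hs)
  simp only [Pi.add_apply, Pi.smul_apply, add_assoc] at hW
  refine (norm_compl_mul_unitary_mul_le (hunit 1 hmem₁) (hP 0 hmem₀) (hP 1 hmem₁) hW).trans ?_
  have hQ₁ : ‖(1 - P 1) * ((T : ℂ)⁻¹ • D 1 + (T : ℂ)⁻¹ ^ 2 • F 1)‖ ≤
      T⁻¹ * ‖(1 - P 1) * D 1‖ + T⁻¹ ^ 2 * δ := by
    rw [mul_add, mul_smul_comm, mul_smul_comm]
    exact norm_add_le_of_le (by rw [norm_smul, hnorm]) <| hnorm₂ <|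
      (norm_mul_le_of_le (hP 1 hmem₁).one_sub.norm_le (hF 1 hmem₁)).trans_eq (one_mul δ)
  have hP₀ : ‖((T : ℂ)⁻¹ • D 0 + (T : ℂ)⁻¹ ^ 2 • F 0) * P 0‖ ≤
      T⁻¹ * ‖D 0 * P 0‖ + T⁻¹ ^ 2 * δ := by
    rw [add_mul, smul_mul_assoc, smul_mul_assoc]
    exact norm_add_le_of_le (by rw [norm_smul, hnorm]) <| hnorm₂ <|
      (norm_mul_le_of_le (hF 0 hmem₀) (hP 0 hmem₀).norm_le).trans_eq (mul_one δ)
  linarith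

end Evolution

section SimpleEigenvector

open InnerProductSpace

variable {V : Type*} [NormedAddCommGroup V] [InnerProductSpace ℂ V] {A : V →L[ℂ] V} {E g : ℝ}
  {x v : V}

/-- `x` is a normalized eigenvector of `A` whose eigenvalue `E` is non-degenerate. -/
structure IsSimpleEigenvector (A : V →L[ℂ] V) (E : ℝ) (x : V) : Prop where
  norm_eq_one : ‖x‖ = 1
  apply_eq : A x = (E : ℂ) • x
  finrank_eigenspace : Module.finrank ℂ (Module.End.eigenspace (A : V →ₗ[ℂ] V) (E : ℂ)) = 1

/-- All energies of `A` other than `E` are at distance at least `g` from `E`. In contrast to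
`g ≤ levelGap A E`, this makes sense if there are no other energies. -/
def IsIsolatedLevel (g : ℝ) (A : V →L[ℂ] V) (E : ℝ) : Prop :=
  ∀ E' ∈ energies A, E' ≠ E → g ≤ |E' - E|

/-- The reduced resolvent of `A` at an eigenvalue `E` with normalized eigenvector `x`: the inverse
of `A - E` on the orthogonal complement of `x`, extended by zero. -/
noncomputable def reducedResolvent (A : V →L[ℂ] V) (E : ℝ) (x : V) : V →L[ℂ] V :=
  Ring.inverse (A - E • 1 + rankOne ℂ x x) - rankOne ℂ x x

theorem IsNondegenerateEigenstate.isSimpleEigenvector {H : ℝ → V →L[ℂ] V} {E : ℝ → ℝ}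
    {G : ℝ → V} (hG : IsNondegenerateEigenstate H E G) {s : ℝ} (hs : s ∈ Icc (0 : ℝ) 1) :
    IsSimpleEigenvector (H s) (E s) (G s) :=
  ⟨hG.norm_eq_one s hs, hG.eigen s hs, hG.nondegenerate s hs⟩

namespace IsSimpleEigenvector

theorem ne_zero (hx : IsSimpleEigenvector A E x) : x ≠ 0 :=
  norm_ne_zero_iff.1 (hx.norm_eq_one.trans_ne one_ne_zero)

theorem mem_energies (hx : IsSimpleEigenvector A E x) : E ∈ energies A :=
  Module.End.hasEigenvalue_of_hasEigenvector
    ⟨Module.End.mem_eigenspace_iff.2 hx.apply_eq, hx.ne_zero⟩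

theorem inner_smul_eq (hx : IsSimpleEigenvector A E x) (hv : A v = (E : ℂ) • v) :
    inner ℂ x v • x = v := by
  obtain ⟨c, hc⟩ := (finrank_eq_one_iff_of_nonzero' (⟨x, Module.End.mem_eigenspace_iff.2
    hx.apply_eq⟩ : Module.End.eigenspace _ _) (Subtype.coe_ne_coe.1 hx.ne_zero)).1
    hx.finrank_eigenspace ⟨v, Module.End.mem_eigenspace_iff.2 hv⟩
  obtain rfl : c • x = v := congr_arg Subtype.val hc
  rw [inner_smul_right, inner_self_eq_norm_sq_to_K, hx.norm_eq_one, RCLike.ofReal_one, one_pow,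
    mul_one]

theorem mul_rankOne (hx : IsSimpleEigenvector A E x) :
    A * rankOne ℂ x x = E • rankOne ℂ x x := by
  ext v
  exact (map_smul A _ x).trans (by rw [hx.apply_eq, smul_comm]; rfl)

variable [FiniteDimensional ℂ V]

theorem rankOne_mul (hx : IsSimpleEigenvector A E x) (hA : IsSelfAdjoint A) :
    rankOne ℂ x x * A = E • rankOne ℂ x x := by
  have hP : star (rankOne ℂ x x) = rankOne ℂ x x :=
    (isStarProjection_rankOne_self hx.norm_eq_one).isSelfAdjoint
  simpa only [star_mul, star_smul, hA.star_eq, hP, star_trivial] using congr_arg star hx.mul_rankOne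

theorem isReducedResolvent (hx : IsSimpleEigenvector A E x) (hA : IsSelfAdjoint A) :
    IsReducedResolvent (A - E • 1) (rankOne ℂ x x) (reducedResolvent A E x) := by
  have hPP := isIdempotentElem_rankOne_self (𝕜 := ℂ) hx.norm_eq_one
  have hZP : (A - E • 1) * rankOne ℂ x x = 0 := by
    rw [sub_mul, hx.mul_rankOne, smul_one_mul, sub_self]
  have hPZ : rankOne ℂ x x * (A - E • 1) = 0 := by
    rw [mul_sub, hx.rankOne_mul hA, mul_smul_one, sub_self]
  have hinj : Function.Injective ⇑(A - E • 1 + rankOne ℂ x x : V →L[ℂ] V) := by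
    refine (injective_iff_map_eq_zero _).2 fun v hv => ?_
    have hPv : rankOne ℂ x x v = 0 := by
      have hmul : rankOne ℂ x x * (A - E • 1 + rankOne ℂ x x) = rankOne ℂ x x := by
        rw [mul_add, hPZ, hPP.eq, zero_add]
      rw [← hmul, mul_apply_eq_comp, hv, map_zero]
    rw [add_apply, hPv, add_zero] at hv
    rwa [rankOne_apply, hx.inner_smul_eq (sub_eq_zero.1 hv)] at hPv
  exact .of_isUnit_add hPP hZP hPZ <| ContinuousLinearMap.isUnit_iff_bijective.2
    ⟨hinj, LinearMap.injective_iff_surjective.1 hinj⟩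

-- Expand `v` in an eigenbasis of `A`: the eigenvectors for the eigenvalue `E` do not contribute.
theorem mul_norm_le (hx : IsSimpleEigenvector A E x) (hA : IsSelfAdjoint A) (hg : 0 ≤ g)
    (hgap : IsIsolatedLevel g A E) (hxv : inner ℂ x v = 0) :
    g * ‖v‖ ≤ ‖(A - E • 1) v‖ := by
  have hs : (A : V →ₗ[ℂ] V).IsSymmetric := ContinuousLinearMap.isSelfAdjoint_iff_isSymmetric.1 hA
  let b := hs.eigenvectorBasis rfl
  let l := hs.eigenvalues rfl
  have hb (i) : A (b i) = (l i : ℂ) • b i := hs.apply_eigenvectorBasis rfl i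
  have hcoef (i) : inner ℂ (b i) ((A - E • 1) v) = ((l i - E : ℝ) : ℂ) * inner ℂ (b i) v := by
    have hsymm : inner ℂ (b i) (A v) = inner ℂ (A (b i)) v := (hs (b i) v).symm
    change inner ℂ (b i) (A v - (E : ℂ) • v) = _
    rw [inner_sub_right, hsymm, hb, inner_smul_left, inner_smul_right, Complex.conj_ofReal,
      Complex.ofReal_sub, sub_mul]
  refine (abs_le_of_sq_le_sq' ?_ (norm_nonneg _)).2
  rw [mul_pow, ← b.sum_sq_norm_inner_right v, ← b.sum_sq_norm_inner_right ((A - E • 1) v),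
    Finset.mul_sum]
  refine Finset.sum_le_sum fun i _ => ?_
  rw [hcoef, norm_mul, Complex.norm_real, Real.norm_eq_abs, mul_pow]
  by_cases hi : l i = E
  · have hbi : inner ℂ x (b i) • x = b i := hx.inner_smul_eq (hi ▸ hb i)
    rw [← hbi, inner_smul_left, hxv]
    simp
  · gcongr
    exact hgap _ (hs.hasEigenvalue_eigenvalues rfl i) hi

theorem norm_reducedResolvent_le (hx : IsSimpleEigenvector A E x) (hA : IsSelfAdjoint A)
    (hg : 0 < g) (hgap : IsIsolatedLevel g A E) :
    ‖reducedResolvent A E x‖ ≤ g⁻¹ := by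
  have hres := hx.isReducedResolvent hA
  refine ContinuousLinearMap.opNorm_le_bound _ (inv_nonneg.2 hg.le) fun w => ?_
  have horth : inner ℂ x (reducedResolvent A E x w) = 0 :=
    (smul_eq_zero.1 congr($hres.proj_mul_res w)).resolve_right hx.ne_zero
  rw [inv_mul_eq_div, le_div_iff₀' hg]
  calc g * ‖reducedResolvent A E x w‖ ≤ ‖(A - E • 1) (reducedResolvent A E x w)‖ :=
        hx.mul_norm_le hA hg.le hgap horth
    _ = ‖(1 - rankOne ℂ x x) w‖ := by rw [← hres.gen_mul_res, mul_apply_eq_comp]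
    _ ≤ 1 * ‖w‖ := ContinuousLinearMap.le_of_opNorm_le _
        (isStarProjection_rankOne_self hx.norm_eq_one).one_sub.norm_le w
    _ = ‖w‖ := one_mul _

-- If `A = E • 1`, then `levelGap A E = 0` is a junk value, but the reduced resolvent vanishes.
theorem norm_reducedResolvent_le_inv_levelGap (hx : IsSimpleEigenvector A E x)
    (hA : IsSelfAdjoint A) (hg : 0 < g) (hgap : IsIsolatedLevel g A E) :
    ‖reducedResolvent A E x‖ ≤ (levelGap A E)⁻¹ := by
  rcases {d | ∃ E' ∈ energies A, E' ≠ E ∧ d = |E' - E|}.eq_empty_or_nonempty with hempty | hne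
  · rw [levelGap, hempty, Real.sInf_empty, inv_zero]
    refine ge_of_tendsto tendsto_inv_atTop_zero ((eventually_gt_atTop (0 : ℝ)).mono fun d hd => ?_)
    exact hx.norm_reducedResolvent_le hA hd fun E' hE' hne =>
      (hempty.le ⟨E', hE', hne, rfl⟩ : |E' - E| ∈ (∅ : Set ℝ)).elim
  · have hle : g ≤ levelGap A E := by
      refine le_csInf hne ?_
      rintro _ ⟨E', hE', hne, rfl⟩
      exact hgap E' hE' hne
    refine hx.norm_reducedResolvent_le hA (hg.trans_le hle) fun E' hE' hne =>
      csInf_le ⟨0, ?_⟩ ⟨E', hE', hne, rfl⟩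
    rintro _ ⟨E'', -, -, rfl⟩
    exact abs_nonneg _

end IsSimpleEigenvector

theorem isIsolatedLevel_of_inv_gapMin_le {H : ℝ → V →L[ℂ] V} {c : ℝ≥0} (hc : 0 < c)
    (h : (gapMin H)⁻¹ ≤ (c : ℝ≥0∞)) {s : ℝ} (hs : s ∈ Icc (0 : ℝ) 1) (hE : E ∈ energies (H s)) :
    IsIsolatedLevel (c : ℝ)⁻¹ (H s) E := by
  intro E' hE' hne
  have hgap : gapMin H ≤ ENNReal.ofReal |E' - E| :=
    (iInf₂_le s hs).trans <| (iInf₂_le E' hE').trans <| (iInf₂_le E hE).trans <| iInf_le _ hne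
  have hinv := (ENNReal.inv_le_iff_inv_le.1 h).trans hgap
  rwa [← ENNReal.coe_inv hc.ne', ENNReal.le_ofReal_iff_toReal_le ENNReal.coe_ne_top (abs_nonneg _),
    ENNReal.coe_toReal, NNReal.coe_inv] at hinv

variable [FiniteDimensional ℂ V]

/-- The real part of the trace, as a bounded real-linear functional. -/
noncomputable def reTrace : (V →L[ℂ] V) →L[ℝ] ℝ :=
  Complex.reCLM.comp ((LinearMap.toContinuousLinearMap
    ((LinearMap.trace ℂ V) ∘ₗ ContinuousLinearMap.coeLM ℂ)).restrictScalars ℝ)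

theorem reTrace_rankOne_self (hx : ‖x‖ = 1) : reTrace (rankOne ℂ x x) = 1 := by
  simp [reTrace, trace_rankOne, hx]

theorem IsTimeEvolution.mem_unitary {T : ℝ} {H U : ℝ → V →L[ℂ] V} (hU : IsTimeEvolution T H U)
    (hH : ∀ s ∈ Icc (0 : ℝ) 1, IsSelfAdjoint (H s)) :
    ∀ s ∈ Icc (0 : ℝ) 1, U s ∈ unitary (V →L[ℂ] V) := by
  intro s hs
  have hUU := star_mul_self_of_schrodinger hH hU.initial hU.schrodinger s hs
  refine Unitary.mem_iff.2 ⟨hUU, ContinuousLinearMap.coe_injective ?_⟩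
  exact mul_eq_one_comm.1 congr(($hUU : V →ₗ[ℂ] V))

end SimpleEigenvector

section Eigenstate

open InnerProductSpace

variable {V : Type*} [NormedAddCommGroup V] [InnerProductSpace ℂ V]
  {H U : ℝ → V →L[ℂ] V} {E : ℝ → ℝ} {G : ℝ → V} {δ s : ℝ}

/-- The spectral projection `|G(s)⟩⟨G(s)|`. -/
noncomputable def stateProj (G : ℝ → V) (s : ℝ) : V →L[ℂ] V := rankOne ℂ (G s) (G s)

theorem IsNondegenerateEigenstate.adiabaticError_le (hG : IsNondegenerateEigenstate H E G) :
    adiabaticError G U ≤ ‖(1 - stateProj G 1) * U 1 * stateProj G 0‖ := by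
  have hG₀ := hG.norm_eq_one 0 (left_mem_Icc.2 zero_le_one)
  have hproj : stateProj G 0 (G 0) = G 0 := by
    rw [stateProj, rankOne_apply, inner_self_eq_norm_sq_to_K, hG₀, RCLike.ofReal_one, one_pow,
      one_smul]
  change ‖(1 - stateProj G 1) (U 1 (G 0))‖ ≤ _
  simpa only [mul_apply_eq_comp, hproj, hG₀, mul_one] using
    ((1 - stateProj G 1) * U 1 * stateProj G 0).le_opNorm (G 0)

variable [FiniteDimensional ℂ V]

/-- The reduced resolvent of `H(s)` at the level `E(s)`. -/
noncomputable def stateRes (H : ℝ → V →L[ℂ] V) (E : ℝ → ℝ) (G : ℝ → V) (s : ℝ) : V →L[ℂ] V :=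
  reducedResolvent (H s) (E s) (G s)

/-- The derivative `H' - E' • 1` of the shifted Hamiltonian `H - E • 1`, where `E'` is expressed
through `H'` and the state `G` by the Hellmann–Feynman formula. -/
noncomputable def shiftedDeriv (H : ℝ → V →L[ℂ] V) (G : ℝ → V) (s : ℝ) : V →L[ℂ] V :=
  hamDeriv 1 H s - reTrace (stateProj G s * hamDeriv 1 H s * stateProj G s) • 1

namespace IsNondegenerateEigenstate

theorem isStarProjection_stateProj (hG : IsNondegenerateEigenstate H E G)
    (hs : s ∈ Icc (0 : ℝ) 1) : IsStarProjection (stateProj G s) :=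
  isStarProjection_rankOne_self (hG.norm_eq_one s hs)

theorem isReducedResolvent (hG : IsNondegenerateEigenstate H E G)
    (hH : ∀ s ∈ Icc (0 : ℝ) 1, IsSelfAdjoint (H s)) :
    ∀ s ∈ Icc (0 : ℝ) 1, IsReducedResolvent (H s - E s • 1) (stateProj G s) (stateRes H E G s) :=
  fun s hs => (hG.isSimpleEigenvector hs).isReducedResolvent (hH s hs)

theorem norm_stateProj_le (hG : IsNondegenerateEigenstate H E G) :
    ∀ s ∈ Icc (0 : ℝ) 1, ‖stateProj G s‖ ≤ 1 :=
  fun _ hs => (hG.isStarProjection_stateProj hs).norm_le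

theorem norm_stateRes_le (hG : IsNondegenerateEigenstate H E G)
    (hH : ∀ s ∈ Icc (0 : ℝ) 1, IsSelfAdjoint (H s)) (hδ : 0 < δ)
    (hgap : ∀ s ∈ Icc (0 : ℝ) 1, IsIsolatedLevel δ (H s) (E s)) :
    ∀ s ∈ Icc (0 : ℝ) 1, ‖stateRes H E G s‖ ≤ δ⁻¹ :=
  fun s hs => (hG.isSimpleEigenvector hs).norm_reducedResolvent_le (hH s hs) hδ (hgap s hs)

theorem hasDerivWithinAt_generator (hG : IsNondegenerateEigenstate H E G)
    (hH : ∀ s ∈ Icc (0 : ℝ) 1, IsSelfAdjoint (H s)) (hδ : 0 < δ)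
    (hgap : ∀ s ∈ Icc (0 : ℝ) 1, IsIsolatedLevel δ (H s) (E s))
    (hs : s ∈ Icc (0 : ℝ) 1) (dH : HasDerivWithinAt H (hamDeriv 1 H s) (Icc 0 1) s) :
    HasDerivWithinAt (fun s => H s - E s • 1) (shiftedDeriv H G s) (Icc 0 1) s := by
  have cZ : ContinuousWithinAt (fun s => H s - E s • 1) (Icc 0 1) s :=
    dH.continuousWithinAt.sub ((hG.level_continuous s hs).smul continuousWithinAt_const)
  have cP : ContinuousWithinAt (stateProj G) (Icc 0 1) s :=
    IsReducedResolvent.continuousWithinAt_proj (K := max 1 δ⁻¹) (hG.isReducedResolvent hH)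
      (fun s hs => le_max_of_le_left (hG.norm_stateProj_le s hs))
      (fun s hs => le_max_of_le_right (hG.norm_stateRes_le hH hδ hgap s hs)) cZ hs
  exact dH.sub <| (hasDerivWithinAt_eigenvalue
    (fun s hs => (hG.isSimpleEigenvector hs).mul_rankOne)
    ((hG.isSimpleEigenvector hs).rankOne_mul (hH s hs))
    (hG.isStarProjection_stateProj hs).isIdempotentElem.eq
    (reTrace_rankOne_self (hG.norm_eq_one s hs)) cP dH).smul_const (1 : V →L[ℂ] V)

theorem hasDerivWithinAt_stateProj (hG : IsNondegenerateEigenstate H E G)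
    (hH : ∀ s ∈ Icc (0 : ℝ) 1, IsSelfAdjoint (H s)) (hδ : 0 < δ)
    (hgap : ∀ s ∈ Icc (0 : ℝ) 1, IsIsolatedLevel δ (H s) (E s))
    (hs : s ∈ Icc (0 : ℝ) 1) (dH : HasDerivWithinAt H (hamDeriv 1 H s) (Icc 0 1) s) :
    HasDerivWithinAt (stateProj G)
      (-(stateRes H E G s * shiftedDeriv H G s * stateProj G s +
        stateProj G s * shiftedDeriv H G s * stateRes H E G s)) (Icc 0 1) s :=
  IsReducedResolvent.hasDerivWithinAt_proj (K := max 1 δ⁻¹) (hG.isReducedResolvent hH)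
    (fun s hs => le_max_of_le_left (hG.norm_stateProj_le s hs))
    (fun s hs => le_max_of_le_right (hG.norm_stateRes_le hH hδ hgap s hs))
    (hG.hasDerivWithinAt_generator hH hδ hgap hs dH) hs

theorem hasDerivWithinAt_stateRes (hG : IsNondegenerateEigenstate H E G)
    (hH : ∀ s ∈ Icc (0 : ℝ) 1, IsSelfAdjoint (H s)) (hδ : 0 < δ)
    (hgap : ∀ s ∈ Icc (0 : ℝ) 1, IsIsolatedLevel δ (H s) (E s))
    (hs : s ∈ Icc (0 : ℝ) 1) (dH : HasDerivWithinAt H (hamDeriv 1 H s) (Icc 0 1) s) :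
    HasDerivWithinAt (stateRes H E G)
      (stateRes H E G s * (stateRes H E G s * shiftedDeriv H G s * stateProj G s) +
        stateProj G s * shiftedDeriv H G s * stateRes H E G s * stateRes H E G s -
        stateRes H E G s * shiftedDeriv H G s * stateRes H E G s) (Icc 0 1) s :=
  IsReducedResolvent.hasDerivWithinAt_res (K := max 1 δ⁻¹) (hG.isReducedResolvent hH)
    (fun s hs => le_max_of_le_left (hG.norm_stateProj_le s hs))
    (fun s hs => le_max_of_le_right (hG.norm_stateRes_le hH hδ hgap s hs))
    (hG.hasDerivWithinAt_generator hH hδ hgap hs dH) hs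

theorem norm_res_mul_res_mul_shiftedDeriv_mul_proj_le (hG : IsNondegenerateEigenstate H E G)
    (hH : ∀ s ∈ Icc (0 : ℝ) 1, IsSelfAdjoint (H s)) (hδ : 0 < δ)
    (hgap : ∀ s ∈ Icc (0 : ℝ) 1, IsIsolatedLevel δ (H s) (E s))
    (hs : s ∈ Icc (0 : ℝ) 1) :
    ‖stateRes H E G s * (stateRes H E G s * shiftedDeriv H G s * stateProj G s)‖ ≤
      ‖hamDeriv 1 H s‖ / levelGap (H s) (E s) ^ 2 := by
  have hR : ‖stateRes H E G s‖ ≤ (levelGap (H s) (E s))⁻¹ :=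
    (hG.isSimpleEigenvector hs).norm_reducedResolvent_le_inv_levelGap (hH s hs) hδ (hgap s hs)
  have hshift : stateRes H E G s * shiftedDeriv H G s * stateProj G s =
      stateRes H E G s * hamDeriv 1 H s * stateProj G s := by
    rw [shiftedDeriv, mul_sub, sub_mul, mul_smul_comm, mul_one, smul_mul_assoc,
      (hG.isReducedResolvent hH s hs).res_mul_proj, smul_zero, sub_zero]
  rw [hshift]
  calc ‖stateRes H E G s * (stateRes H E G s * hamDeriv 1 H s * stateProj G s)‖
      ≤ (levelGap (H s) (E s))⁻¹ * ((levelGap (H s) (E s))⁻¹ * ‖hamDeriv 1 H s‖ * 1) :=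
        norm_mul_le_of_le hR <|
          norm_mul_le_of_le (norm_mul_le_of_le hR le_rfl) (hG.norm_stateProj_le s hs)
    _ = ‖hamDeriv 1 H s‖ / levelGap (H s) (E s) ^ 2 := by ring

end IsNondegenerateEigenstate

end Eigenstate

section AdiabaticLimit

theorem eventually_norm_compl_mul_evolution_mul_proj_le {A : Type*} [NormedRing A] [StarRing A]
    [CStarRing A] [NormedAlgebra ℂ A] [StarModule ℂ A] {H U P D F : ℝ → ℝ → A} {ε : ℝ}
    (hH : ∀ T > 0, ∀ s ∈ Icc (0 : ℝ) 1, IsSelfAdjoint (H T s)) (hU₀ : ∀ T > 0, U T 0 = 1)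
    (hU : ∀ T > 0, ∀ s ∈ Icc (0 : ℝ) 1,
      HasDerivWithinAt (U T) (-(Complex.I * (T : ℂ)) • (H T s * U T s)) (Icc 0 1) s)
    (hunit : ∀ T > 0, ∀ s ∈ Icc (0 : ℝ) 1, U T s ∈ unitary A)
    (hP : ∀ T > 0, ∀ s ∈ Icc (0 : ℝ) 1, IsStarProjection (P T s))
    (hHP : ∀ T > 0, ∀ s ∈ Icc (0 : ℝ) 1, H T s * P T s = P T s * H T s)
    (dP : HasDerivOnUnit P (-(Complex.I • (H * D - D * H))))
    (dD : HasDerivOnUnit D (-(Complex.I • (H * F - F * H))))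
    (hF : IsSymbol 1 1 F) (hε : 0 < ε) :
    ∀ᶠ T in atTop, ‖(1 - P T 1) * U T 1 * P T 0‖ ≤
      T⁻¹ * (‖(1 - P T 1) * D T 1‖ + ‖D T 0 * P T 0‖) + ε * (1 / T) := by
  obtain ⟨hF, F', dF, hF'⟩ := hF
  have bound {f : ℝ → ℝ → A} {m : ℕ} (hf : HasOrder m f) (hm : m = 2) :
      ∀ᶠ T in atTop, ∀ s ∈ Icc (0 : ℝ) 1, ‖f T s‖ ≤ ε / 3 * ‖√T ^ 2‖ := by
    subst hm
    exact eventually_unifAtTop.1 (isLittleO_iff.1 (hf.isLittleO two_pos) (by positivity))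
  filter_upwards [bound hF.succ rfl, bound hF'.hasOrder rfl, eventually_gt_atTop 0]
    with T hFT hF'T hT
  have hsq : ε / 3 * ‖√T ^ 2‖ = ε / 3 * T := by rw [Real.sq_sqrt hT.le, Real.norm_of_nonneg hT.le]
  refine (norm_compl_mul_evolution_mul_proj_le hT (hH T hT) (hU₀ T hT) (hU T hT) (hunit T hT)
    (hP T hT) (hHP T hT) (dP T hT) (dD T hT) (dF T hT) hFT hF'T).trans_eq ?_
  rw [hsq]
  field_simp

variable {V : Type*} [NormedAddCommGroup V] [InnerProductSpace ℂ V] {H U : ℝ → ℝ → V →L[ℂ] V}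
  {E : ℝ → ℝ → ℝ} {G : ℝ → ℝ → V} {k m : ℕ} {g : ℝ → ℝ} {T δ ε : ℝ}

theorem ThriceDifferentiable.hasDerivOnUnit (hH : ∀ T > 0, ThriceDifferentiable (H T))
    (hk : k < 3) :
    HasDerivOnUnit (fun T => hamDeriv k (H T)) fun T => hamDeriv (k + 1) (H T) := by
  intro T hT s hs
  have hsucc : hamDeriv (k + 1) (H T) = derivWithin (hamDeriv k (H T)) (Icc 0 1) :=
    iteratedDerivWithin_succ
  simpa only [hsucc] using (hH T hT k hk s hs).hasDerivWithinAt

theorem DerivNormBounded.hasOrder (h : DerivNormBounded k H) :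
    HasOrder 0 fun T => hamDeriv k (H T) :=
  h.elim fun _ hb => .zero_of_bounded hb

theorem DerivNormIsLittleO.hasOrder (h : DerivNormIsLittleO k H g)
    (hg : ∀ᶠ T in atTop, g T = √T ^ m) : HasOrder m fun T => hamDeriv k (H T) := by
  refine .of_isLittleO (isLittleO_iff.2 fun ε hε => eventually_unifAtTop.2 ?_)
  filter_upwards [h ε hε, hg] with T hT hgT s hs
  rw [Real.norm_of_nonneg (by positivity), ← hgT]
  exact hT s hs

theorem isSymbol_hamDeriv_one (hdiff : ∀ T > 0, ThriceDifferentiable (H T))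
    (hH1 : DerivNormBounded 1 H) (hH2 : DerivNormIsLittleO 2 H fun T => √T)
    (hH3 : DerivNormIsLittleO 3 H fun T => T) : IsSymbol 2 0 fun T => hamDeriv 1 (H T) :=
  ⟨hH1.hasOrder, _, ThriceDifferentiable.hasDerivOnUnit hdiff (by norm_num),
    hH2.hasOrder (.of_forall fun T => (pow_one √T).symm), _,
    ThriceDifferentiable.hasDerivOnUnit hdiff (by norm_num),
    hH3.hasOrder ((eventually_ge_atTop 0).mono fun _ hT => (Real.sq_sqrt hT).symm)⟩

theorem standardEstimate_nonneg (hT : 0 ≤ T) (H : ℝ → V →L[ℂ] V) (E : ℝ → ℝ) :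
    0 ≤ standardEstimate T H E :=
  le_max_of_le_left (by positivity)

variable [FiniteDimensional ℂ V]

theorem isSymbol_stateProj_and_stateRes
    (hsa : ∀ T > 0, ∀ s ∈ Icc (0 : ℝ) 1, IsSelfAdjoint (H T s))
    (hG : ∀ T > 0, IsNondegenerateEigenstate (H T) (E T) (G T))
    (dH : HasDerivOnUnit H fun T => hamDeriv 1 (H T))
    (hh : IsSymbol 2 0 fun T => hamDeriv 1 (H T)) (hδ : 0 < δ)
    (hgap : ∀ T > 0, ∀ s ∈ Icc (0 : ℝ) 1, IsIsolatedLevel δ (H T s) (E T s)) :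
    IsSymbol 2 0 (fun T => stateProj (G T)) ∧
      IsSymbol 2 0 fun T => stateRes (H T) (E T) (G T) :=
  IsSymbol.proj_and_res (z := fun T => shiftedDeriv (H T) (G T))
    (reTrace.smulRight (1 : V →L[ℂ] V))
    (.zero_of_bounded fun T hT => (hG T hT).norm_stateProj_le)
    (.zero_of_bounded fun T hT => (hG T hT).norm_stateRes_le (hsa T hT) hδ (hgap T hT)) rfl
    (fun T hT s hs => (hG T hT).hasDerivWithinAt_stateProj (hsa T hT) hδ (hgap T hT) hs
      (dH T hT s hs))
    (fun T hT s hs => (hG T hT).hasDerivWithinAt_stateRes (hsa T hT) hδ (hgap T hT) hs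
      (dH T hT s hs)) hh

theorem exists_superadiabatic_corrections
    (hsa : ∀ T > 0, ∀ s ∈ Icc (0 : ℝ) 1, IsSelfAdjoint (H T s))
    (hG : ∀ T > 0, IsNondegenerateEigenstate (H T) (E T) (G T))
    (dH : HasDerivOnUnit H fun T => hamDeriv 1 (H T))
    (hh : IsSymbol 2 0 fun T => hamDeriv 1 (H T)) (hδ : 0 < δ)
    (hgap : ∀ T > 0, ∀ s ∈ Icc (0 : ℝ) 1, IsIsolatedLevel δ (H T s) (E T s)) :
    ∃ D F : ℝ → ℝ → V →L[ℂ] V, IsSymbol 1 1 F ∧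
      HasDerivOnUnit (fun T => stateProj (G T)) (-(Complex.I • (H * D - D * H))) ∧
      HasDerivOnUnit D (-(Complex.I • (H * F - F * H))) ∧
      ∀ T > 0, ∀ s ∈ Icc (0 : ℝ) 1,
        ‖D T s * stateProj (G T) s‖ ≤ ‖hamDeriv 1 (H T) s‖ / levelGap (H T s) (E T s) ^ 2 ∧
        ‖(1 - stateProj (G T) s) * D T s‖ ≤
          ‖hamDeriv 1 (H T) s‖ / levelGap (H T s) (E T s) ^ 2 := by
  set P := fun T => stateProj (G T)
  set R := fun T => stateRes (H T) (E T) (G T)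
  set z := fun T => shiftedDeriv (H T) (G T)
  have hres : ∀ T > 0, ∀ s ∈ Icc (0 : ℝ) 1,
      IsReducedResolvent (H T s - E T s • 1) (P T s) (R T s) :=
    fun T hT => (hG T hT).isReducedResolvent (hsa T hT)
  have dP : HasDerivOnUnit P (-(R * z * P + P * z * R)) := fun T hT s hs =>
    (hG T hT).hasDerivWithinAt_stateProj (hsa T hT) hδ (hgap T hT) hs (dH T hT s hs)
  obtain ⟨hP, hR⟩ := isSymbol_stateProj_and_stateRes hsa hG dH hh hδ hgap
  have hz : IsSymbol 2 0 z := hP.sub_map_compression (reTrace.smulRight (1 : V →L[ℂ] V)) hh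
  have hcomm (X : ℝ → ℝ → V →L[ℂ] V) :
      (fun T s => H T s - E T s • 1) * X - X * (fun T s => H T s - E T s • 1) =
        H * X - X * H := by
    funext T s
    simp only [Pi.sub_apply, Pi.mul_apply, sub_mul, mul_sub, smul_one_mul, mul_smul_one,
      sub_sub_sub_cancel_right]
  obtain ⟨F, hF, dD⟩ := exists_hasDerivOnUnit_firstCorrection_eq_commutator hres hP hR hz dP
  rw [hcomm] at dD
  refine ⟨firstCorrection P R z, F, hF, ?_, dD, fun T hT s hs => ?_⟩
  · rw [← hcomm]
    exact fun T hT s hs => (dP T hT s hs).congr_deriv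
      ((hres T hT s hs).commutator_firstCorrection (z T s)).symm
  · have hbound : ‖-(Complex.I • (R T s * (R T s * z T s * P T s)))‖ ≤
        ‖hamDeriv 1 (H T) s‖ / levelGap (H T s) (E T s) ^ 2 := by
      rw [norm_neg, norm_smul, Complex.norm_I, one_mul]
      exact (hG T hT).norm_res_mul_res_mul_shiftedDeriv_mul_proj_le (hsa T hT) hδ (hgap T hT) hs
    have hDP := (hres T hT s hs).firstCorrection_mul_proj (z T s)
    have hQD := (hres T hT s hs).compl_mul_firstCorrection (z T s)
    exact ⟨hDP ▸ hbound, hQD ▸ hbound⟩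

theorem eventually_adiabaticError_le
    (hsa : ∀ T > 0, ∀ s ∈ Icc (0 : ℝ) 1, IsSelfAdjoint (H T s))
    (hdiff : ∀ T > 0, ThriceDifferentiable (H T))
    (hG : ∀ T > 0, IsNondegenerateEigenstate (H T) (E T) (G T))
    (hU : ∀ T > 0, IsTimeEvolution T (H T) (U T)) (hH1 : DerivNormBounded 1 H)
    (hH2 : DerivNormIsLittleO 2 H fun T => √T) (hH3 : DerivNormIsLittleO 3 H fun T => T)
    (hδ : 0 < δ)
    (hgap : ∀ T > 0, ∀ s ∈ Icc (0 : ℝ) 1, IsIsolatedLevel δ (H T s) (E T s)) (hε : 0 < ε) :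
    ∀ᶠ T in atTop, adiabaticError (G T) (U T) ≤
      2 * standardEstimate T (H T) (E T) + ε * (1 / T) := by
  have dH : HasDerivOnUnit H fun T => hamDeriv 1 (H T) := by
    simpa only [hamDeriv, iteratedDerivWithin_zero] using
      ThriceDifferentiable.hasDerivOnUnit hdiff three_pos
  obtain ⟨D, F, hF, dP, dD, hD⟩ := exists_superadiabatic_corrections hsa hG dH
    (isSymbol_hamDeriv_one hdiff hH1 hH2 hH3) hδ hgap
  have hHP : ∀ T > 0, ∀ s ∈ Icc (0 : ℝ) 1,
      H T s * stateProj (G T) s = stateProj (G T) s * H T s := fun T hT s hs =>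
    ((hG T hT).isSimpleEigenvector hs).mul_rankOne.trans
      (((hG T hT).isSimpleEigenvector hs).rankOne_mul (hsa T hT s hs)).symm
  filter_upwards [eventually_gt_atTop 0, eventually_norm_compl_mul_evolution_mul_proj_le hsa
    (fun T hT => (hU T hT).initial) (fun T hT => (hU T hT).schrodinger)
    (fun T hT => (hU T hT).mem_unitary (hsa T hT))
    (fun T hT s hs => (hG T hT).isStarProjection_stateProj hs) hHP dP dD hF hε] with T hT hle
  have hleft : T⁻¹ * ‖D T 0 * stateProj (G T) 0‖ ≤ standardEstimate T (H T) (E T) := by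
    refine le_max_of_le_left ?_
    rw [← div_div, div_eq_inv_mul _ T]
    gcongr
    exact (hD T hT 0 (left_mem_Icc.2 zero_le_one)).1
  have hright : T⁻¹ * ‖(1 - stateProj (G T) 1) * D T 1‖ ≤ standardEstimate T (H T) (E T) := by
    refine le_max_of_le_right ?_
    rw [← div_div, div_eq_inv_mul _ T]
    gcongr
    exact (hD T hT 1 (right_mem_Icc.2 zero_le_one)).2
  linarith [(hG T hT).adiabaticError_le (U := U T)]

end AdiabaticLimit

theorem corollary1_general {V : Type*} [NormedAddCommGroup V] [InnerProductSpace ℂ V]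
    [FiniteDimensional ℂ V] (H : ℝ → ℝ → V →L[ℂ] V) (E : ℝ → ℝ → ℝ) (G : ℝ → ℝ → V)
    (U : ℝ → ℝ → V →L[ℂ] V)
    (hsa : ∀ T > 0, ∀ s ∈ Icc (0 : ℝ) 1, IsSelfAdjoint (H T s))
    (hdiff : ∀ T > 0, ThriceDifferentiable (H T))
    (hG : ∀ T > 0, IsNondegenerateEigenstate (H T) (E T) (G T))
    (hU : ∀ T > 0, IsTimeEvolution T (H T) (U T))
    (hH1 : DerivNormBounded 1 H)
    (hgap : ∃ δ > 0, ∀ T > 0, ∀ s ∈ Icc (0 : ℝ) 1, IsIsolatedLevel δ (H T s) (E T s))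
    (hH2 : DerivNormIsLittleO 2 H (fun T => √T))
    (hH3 : DerivNormIsLittleO 3 H (fun T => T)) :
    ((∃ a > 0, ∀ᶠ T in atTop, a / T ≤ standardEstimate T (H T) (E T)) →
      (fun T => adiabaticError (G T) (U T)) =O[atTop]
        (fun T => standardEstimate T (H T) (E T))) ∧
    (∃ (C : ℝ) (r : ℝ → ℝ), r =o[atTop] (fun T => 1 / T) ∧
      ∀ᶠ T in atTop,
        adiabaticError (G T) (U T) ≤ C * standardEstimate T (H T) (E T) + r T) := by
  obtain ⟨δ, hδ, hgap⟩ := hgap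
  obtain ⟨r, hr, hle⟩ := exists_isLittleO_le_add
    ((eventually_gt_atTop 0).mono fun T hT => (one_div_pos.2 hT).le)
    fun ε hε => eventually_adiabaticError_le hsa hdiff hG hU hH1 hH2 hH3 hδ hgap hε
  refine ⟨fun ⟨a, ha, hlower⟩ => ?_, 2, r, hr, .of_forall hle⟩
  refine .trans (IsBigO.of_bound' (.of_forall fun T => ?_)) <|
    (isBigO_const_mul_self 2 (fun T => standardEstimate T (H T) (E T)) atTop).add <|
      hr.isBigO.trans <| IsBigO.of_bound a⁻¹ ?_
  · exact (norm_norm _).trans_le ((hle T).trans (le_abs_self _))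
  · filter_upwards [hlower, eventually_gt_atTop 0] with T hT hpos
    rw [Real.norm_of_nonneg (by positivity),
      Real.norm_of_nonneg (standardEstimate_nonneg hpos.le ..), ← div_eq_inv_mul,
      le_div_iff₀' ha, mul_one_div]
    exact hT

theorem corollary1 {N : ℕ}
    (H : ℝ → ℝ → Op N) (E : ℝ → ℝ → ℝ) (G : ℝ → ℝ → StateSpace N) (U : ℝ → ℝ → Op N)
    (hsa : ∀ T > 0, ∀ s ∈ Icc (0 : ℝ) 1, IsSelfAdjoint (H T s))
    (hdiff : ∀ T > 0, ThriceDifferentiable (H T))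
    (hG : ∀ T > 0, IsNondegenerateEigenstate (H T) (E T) (G T))
    (hU : ∀ T > 0, IsTimeEvolution T (H T) (U T))
    (hH1 : DerivNormBounded 1 H)
    (hgap : ∃ c : ℝ≥0, ∀ T > 0, (gapMin (H T))⁻¹ ≤ (c : ℝ≥0∞))
    (hH2 : DerivNormIsLittleO 2 H (fun T => √T))
    (hH3 : DerivNormIsLittleO 3 H (fun T => T)) :
    ((∃ a > 0, ∀ᶠ T in atTop, a / T ≤ standardEstimate T (H T) (E T)) →
      (fun T => adiabaticError (G T) (U T)) =O[atTop]
        (fun T => standardEstimate T (H T) (E T))) ∧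
    (∃ (C : ℝ) (r : ℝ → ℝ), r =o[atTop] (fun T => 1 / T) ∧
      ∀ᶠ T in atTop,
        adiabaticError (G T) (U T) ≤ C * standardEstimate T (H T) (E T) + r T) := by
  obtain ⟨c, hc⟩ := hgap
  exact corollary1_general H E G U hsa hdiff hG hU hH1 ⟨(c + 1 : ℝ≥0)⁻¹, by positivity,
    fun T hT s hs => isIsolatedLevel_of_inv_gapMin_le (by positivity)
      ((hc T hT).trans (by simp)) hs ((hG T hT).isSimpleEigenvector hs).mem_energies⟩ hH2 hH3
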